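/- Let $K$ be a field, let $G=(V,E)$ be a finite simple graph and let $k\ge 2$. The $k$-subdivision $S_k(G)$ is the graph obtained from $G$ by replacing every edge $e=\{u,v\}$ by a path $u,x(e)_1,\dots,x(e)_{k-1},v$ with $k$ edges, where the $x(e)_i$ are new, pairwise distinct vertices. For a finite simple graph $H$, the toric ideal $I_H\subseteq K[e : e\in E(H)]$ is the ideal generated by all binomials $\mathbf x^{\mathbf u}-\mathbf x^{\mathbf v}$ with $\sum_e u_e a_e=\sum_e v_e a_e$, where $a_e=\mathbf p+\mathbf q\in\mathbb Z^{V(H)}$ (a sum of two unit vectors) for an edge $e=\{p,q\}$. A Markov basis of $I_H$ is an inclusion-minimal generating set of $I_H$ consisting of binomials $\mathbf x^{\mathbf u}-\mathbf x^{\mathbf v}$. The universal Gröbner basis $\mathcal U_H$ is the union of the reduced Gröbner bases of $I_H$ over all term orders. The Graver basis $Gr_H$ is the set of primitive binomials of $I_H$, i.e. the nonzero binomials $\mathbf x^{\mathbf u}-\mathbf x^{\mathbf v}\in I_H$ whose two monomials are coprime and for which no other nonzero binomial $\mathbf x^{\mathbf w}-\mathbf x^{\mathbf z}\in I_H$ satisfies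 $\mathbf x^{\mathbf w}\mid\mathbf x^{\mathbf u}$ and $\mathbf x^{\mathbf z}\mid\mathbf x^{\mathbf v}$. Then the toric ideal $I_{S_k(G)}$ is strongly robust: it has a Markov basis, and for every Markov basis $M$ of $I_{S_k(G)}$, $$M=\mathcal U_{S_k(G)}=Gr_{S_k(G)},$$ where binomials are identified up to sign. -/

import Mathlib

namespace ToricBases

open MvPolynomial

section Toric

variable {σ ι : Type*}

/-- The `A`-degree `∑ uᵢ aᵢ` of the monomial `x^u`, for a vector configuration
`A = {aᵢ | i ∈ σ}` in `ℤ^ι`. -/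
def degA (a : σ → ι → ℤ) (u : σ →₀ ℕ) : ι → ℤ :=
  u.sum fun i n => n • a i

/-- The pure difference binomial `x^u - x^v`. -/
noncomputable def binom (K : Type*) [Field K] (u v : σ →₀ ℕ) : MvPolynomial σ K :=
  monomial u 1 - monomial v 1

/-- The toric ideal `I_A`, generated by all binomials `x^u - x^v` with `deg_A x^u = deg_A x^v`. -/
noncomputable def toricIdeal (K : Type*) [Field K] (a : σ → ι → ℤ) : Ideal (MvPolynomial σ K) :=
  Ideal.span {f | ∃ u v : σ →₀ ℕ, degA a u = degA a v ∧ f = binom K u v}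

variable {K : Type*} [Field K]

/-- A Markov basis of `I`: a set of (nonzero) binomials which generates `I` and no proper subset
of which generates `I`. -/
def IsMarkovBasis (I : Ideal (MvPolynomial σ K)) (M : Set (MvPolynomial σ K)) : Prop :=
  (∀ f ∈ M, ∃ u v : σ →₀ ℕ, u ≠ v ∧ f = binom K u v) ∧
  Ideal.span M = I ∧
  ∀ N : Set (MvPolynomial σ K), N ⊂ M → Ideal.span N ≠ I

/-- The Graver basis of `I`: the set of primitive binomials of `I`, i.e. of the nonzero binomials
`x^u - x^v` in `I`, without common monomial factor, for which no other nonzero binomial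
`x^w - x^z` in `I` satisfies `x^w ∣ x^u` and `x^z ∣ x^v`.
(It contains `f` if and only if it contains `-f`.) -/
def graverBasis (I : Ideal (MvPolynomial σ K)) : Set (MvPolynomial σ K) :=
  {f | ∃ u v : σ →₀ ℕ, f = binom K u v ∧ u ≠ v ∧ f ∈ I ∧ Disjoint u.support v.support ∧
    ∀ w z : σ →₀ ℕ, w ≠ z → binom K w z ∈ I → w ≤ u → z ≤ v → w = u ∧ z = v}

/-- `S` is the reduced Gröbner basis of `I` for the term order `m`: it consists of monic elements
of `I`, its leading terms generate the initial ideal of `I`, and no monomial of an element `g` of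
`S` is divisible by the leading monomial of another element of `S`. -/
def IsReducedGroebnerBasis (m : MonomialOrder σ) (I : Ideal (MvPolynomial σ K))
    (S : Set (MvPolynomial σ K)) : Prop :=
  (∀ g ∈ S, g ∈ I ∧ m.leadingCoeff g = 1) ∧
  Ideal.span (m.leadingTerm '' S) = Ideal.span (m.leadingTerm '' (I : Set (MvPolynomial σ K))) ∧
  ∀ g ∈ S, ∀ h ∈ S, h ≠ g → ∀ d ∈ g.support, ¬ m.degree h ≤ d

/-- `S` together with the negatives of its elements: two sets of binomials are equal up to sign
if and only if their sign closures are equal. -/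
def signClosure (S : Set (MvPolynomial σ K)) : Set (MvPolynomial σ K) :=
  {f | f ∈ S ∨ -f ∈ S}

end Toric

section UGB

universe u

/-- The universal Gröbner basis: the union of the reduced Gröbner bases over all term orders.
(Any term order can be realised on a type in the universe of `σ →₀ ℕ`.) -/
def universalGroebnerBasis {σ : Type u} {K : Type*} [Field K] (I : Ideal (MvPolynomial σ K)) :
    Set (MvPolynomial σ K) :=
  {f | ∃ (m : MonomialOrder.{u, u} σ) (S : Set (MvPolynomial σ K)),
    IsReducedGroebnerBasis m I S ∧ f ∈ S}

end UGB

section Graph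

variable {V : Type*}

open Classical in
/-- The vector `a_e = v_i + v_j` in `ℤ^V` of an edge `e = {v_i, v_j}`. -/
noncomputable def edgeVector (G : SimpleGraph V) (e : G.edgeSet) : V → ℤ :=
  fun v => if v ∈ (e : Sym2 V) then 1 else 0

/-- The toric ideal `I_G` of a graph, in the polynomial ring whose variables are the edges. -/
noncomputable def graphIdeal (K : Type*) [Field K] (G : SimpleGraph V) :
    Ideal (MvPolynomial G.edgeSet K) :=
  toricIdeal K (edgeVector G)

/-- The `i`-th vertex, `0 ≤ i ≤ k`, of the path `p, x(e)_1, …, x(e)_{k-1}, q` which replaces the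
edge `e = {p, q}` in the `k`-subdivision, where `o e = (p, q)`; the vertex `x(e)_i` is `(e, i-1)`. -/
def subdivisionPoint (G : SimpleGraph V) (k : ℕ) (o : G.edgeSet → V × V) (e : G.edgeSet) (i : ℕ) :
    V ⊕ (G.edgeSet × Fin (k - 1)) :=
  if i = 0 then Sum.inl (o e).1
  else if h : i - 1 < k - 1 then Sum.inr (e, ⟨i - 1, h⟩)
  else Sum.inl (o e).2

/-- The `k`-subdivision `S_k(G)`: each edge `e` is replaced by a path with `k` edges between its
endpoints. The function `o` lists the two endpoints of each edge, which fixes the direction in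
which the new vertices on that edge are numbered. -/
def subdivision (G : SimpleGraph V) (k : ℕ) (o : G.edgeSet → V × V) :
    SimpleGraph (V ⊕ (G.edgeSet × Fin (k - 1))) :=
  SimpleGraph.fromEdgeSet
    {s | ∃ e : G.edgeSet, ∃ i < k,
      s = s(subdivisionPoint G k o e i, subdivisionPoint G k o e (i + 1))}

end Graph

end ToricBases

/-!
The subdivision has, on every edge, a vertex of degree two (as `2 ≤ k`). The coordinate of the
`A`-degree at such a vertex is the sum of the exponents of the two edges there, so every vector of
the lattice of relations takes opposite values at these two edges
(`isLawrenceType_subdivision`). The configuration thus behaves like a Lawrence lifting, and the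
theorem is the one known for Lawrence liftings.

Let `x^u - x^v` and `x^w - x^z` be binomials of the toric ideal, each with coprime monomials. If
`x^w` divides `x^u`, then `x^z` divides `x^v`, because `z` is `w` transported along the pairing of
the edges (`IsLawrenceType.le_of_le`). Two consequences for primitive binomials follow:

* the fibre of `x^u - x^v` is `{u, v}` (`IsLawrenceType.eq_or_eq`), so that the binomial is
  indispensable, i.e. contained up to sign in each generating set of binomials
  (`IsLawrenceType.mem_signClosure`);
* no monomial of a primitive binomial divides a monomial of a different one
  (`IsLawrenceType.eq_of_degree_le`).

For any toric ideal the Graver basis generates (`span_graverBasis`), and its monic elements form a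
Gröbner basis for every term order (`exists_monicGraver_degree_le`). Together with
indispensability, a minimal generating set of binomials is the Graver basis up to sign. Together
with the second consequence, the monic primitive binomials form a reduced Gröbner basis for every
term order, and it is the only one (`IsReducedGroebnerBasis.subset`).
-/
namespace ToricBases

open MvPolynomial

section Toric

variable {σ ι : Type*}

/-! ### Degrees and primitive pairs -/

theorem degA_add (a : σ → ι → ℤ) (u v : σ →₀ ℕ) : degA a (u + v) = degA a u + degA a v := by
  classical
  exact Finsupp.sum_add_index' (fun i => zero_smul ℕ (a i)) (fun i m n => add_smul m n (a i))

/-- A pair `(u, v)` of exponent vectors such that `x^u - x^v` is a primitive binomial of the toric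
ideal of `a`, phrased without reference to a coefficient field. -/
structure IsPrimitivePair (a : σ → ι → ℤ) (u v : σ →₀ ℕ) : Prop where
  ne : u ≠ v
  degA_eq : degA a u = degA a v
  disjoint : Disjoint u.support v.support
  minimal : ∀ w z : σ →₀ ℕ, w ≠ z → degA a w = degA a z → w ≤ u → z ≤ v → w = u ∧ z = v

theorem IsPrimitivePair.symm {a : σ → ι → ℤ} {u v : σ →₀ ℕ} (h : IsPrimitivePair a u v) :
    IsPrimitivePair a v u where
  ne := h.ne.symm
  degA_eq := h.degA_eq.symm
  disjoint := h.disjoint.symm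
  minimal w z hwz hd hw hz := (h.minimal z w hwz.symm hd.symm hz hw).symm

/-- The pairs of exponent vectors of equal `A`-degree are built from primitive pairs by
multiplying both monomials with a common factor and by adding pairs. -/
theorem primitive_induction {a : σ → ι → ℤ} {P : (σ →₀ ℕ) → (σ →₀ ℕ) → Prop}
    (zero : P 0 0) (prim : ∀ u v, IsPrimitivePair a u v → P u v)
    (shift : ∀ u v c, P u v → P (u + c) (v + c))
    (add : ∀ w z w' z', P w z → P w' z' → P (w + w') (z + z'))
    (u v : σ →₀ ℕ) (huv : degA a u = degA a v) : P u v := by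
  classical
  induction hn : (u + v).degree using Nat.strong_induction_on generalizing u v with
  | _ n ih =>
  subst hn
  have hpos : ∀ x : σ →₀ ℕ, x ≠ 0 → 0 < x.degree := fun x hx =>
    Nat.pos_of_ne_zero fun h => hx ((Finsupp.degree_eq_zero_iff x).1 h)
  by_cases heq : u = v
  · subst heq
    simpa using shift 0 0 u zero
  by_cases hdis : Disjoint u.support v.support
  · by_cases hmin : ∀ w z : σ →₀ ℕ, w ≠ z → degA a w = degA a z → w ≤ u → z ≤ v → w = u ∧ z = v
    · exact prim u v ⟨heq, huv, hdis, hmin⟩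
    push Not at hmin
    obtain ⟨w, z, hwz, hd, hwu, hzv, hne⟩ := hmin
    obtain ⟨w', rfl⟩ := exists_add_of_le hwu
    obtain ⟨z', rfl⟩ := exists_add_of_le hzv
    have hd' : degA a w' = degA a z' := by
      rw [degA_add, degA_add, hd] at huv
      exact add_left_cancel huv
    have h1 : w + z ≠ 0 := fun h => by
      obtain ⟨rfl, rfl⟩ := add_eq_zero.1 h
      exact hwz rfl
    have h2 : w' + z' ≠ 0 := fun h => by
      obtain ⟨rfl, rfl⟩ := add_eq_zero.1 h
      simp at hne
    have h1' := hpos _ h1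
    have h2' := hpos _ h2
    simp only [map_add] at h1' h2'
    refine add _ _ _ _ (ih _ ?_ _ _ hd rfl) (ih _ ?_ _ _ hd' rfl) <;> simp only [map_add] <;> omega
  · rw [← Finsupp.disjoint_iff, disjoint_iff] at hdis
    have hc := hpos _ hdis
    obtain ⟨u', hu'⟩ := exists_add_of_le (inf_le_left : u ⊓ v ≤ u)
    obtain ⟨v', hv'⟩ := exists_add_of_le (inf_le_right : u ⊓ v ≤ v)
    set c := u ⊓ v
    rw [add_comm] at hu' hv'
    have hd' : degA a u' = degA a v' := by
      rw [hu', hv', degA_add, degA_add] at huv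
      exact add_right_cancel huv
    have := ih (u' + v').degree (by
      conv_rhs => rw [hu', hv']
      simp only [map_add]; omega) u' v' hd' rfl
    rw [hu', hv']
    exact shift _ _ _ this

/-- For a monomial order, a pair with `v < u` dominates a primitive pair oriented the same way. -/
theorem exists_isPrimitivePair_le {a : σ → ι → ℤ} (m : MonomialOrder σ) (u v : σ →₀ ℕ)
    (huv : degA a u = degA a v) :
    m.toSyn v < m.toSyn u →
      ∃ w z, IsPrimitivePair a w z ∧ w ≤ u ∧ z ≤ v ∧ m.toSyn z < m.toSyn w := by
  refine primitive_induction (a := a) (P := fun u v => m.toSyn v < m.toSyn u →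
      ∃ w z, IsPrimitivePair a w z ∧ w ≤ u ∧ z ≤ v ∧ m.toSyn z < m.toSyn w)
    (fun h => absurd h (lt_irrefl _)) (fun u v h hlt => ⟨u, v, h, le_rfl, le_rfl, hlt⟩)
    ?_ ?_ u v huv
  · intro u v c ih hlt
    simp only [map_add, add_lt_add_iff_right] at hlt
    obtain ⟨w, z, h, hw, hz, hl⟩ := ih hlt
    exact ⟨w, z, h, hw.trans le_self_add, hz.trans le_self_add, hl⟩
  · intro w z w' z' ih ih' hlt
    simp only [map_add] at hlt
    rcases lt_or_lt_of_add_lt_add hlt with h | h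
    · obtain ⟨x, y, h, hx, hy, hl⟩ := ih h
      exact ⟨x, y, h, hx.trans le_self_add, hy.trans le_self_add, hl⟩
    · obtain ⟨x, y, h, hx, hy, hl⟩ := ih' h
      exact ⟨x, y, h, hx.trans le_add_self, hy.trans le_add_self, hl⟩

/-! ### Configurations of Lawrence type -/

/-- Every coordinate has a partner such that each vector of the lattice of relations of `a` takes
opposite values at the two. -/
def IsLawrenceType (a : σ → ι → ℤ) : Prop :=
  ∀ i, ∃ j, ∀ u v : σ →₀ ℕ, degA a u = degA a v → u i + u j = v i + v j

/-- For Lawrence type, divisibility of one pair of monomials forces that of the other pair: the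
value of `z` at `i` is the value of `w` at the partner of `i`. -/
theorem IsLawrenceType.le_of_le {a : σ → ι → ℤ} (h : IsLawrenceType a) {u v w z : σ →₀ ℕ}
    (huv : degA a u = degA a v) (hwz : degA a w = degA a z)
    (duv : Disjoint u.support v.support) (dwz : Disjoint w.support z.support)
    (hwu : w ≤ u) : z ≤ v := by
  have key : ∀ {x y : σ →₀ ℕ}, Disjoint x.support y.support → ∀ i, x i = 0 ∨ y i = 0 := by
    intro x y hd i
    by_contra! hne
    exact Finset.disjoint_left.1 hd (Finsupp.mem_support_iff.2 hne.1)
      (Finsupp.mem_support_iff.2 hne.2)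
  intro i
  obtain ⟨j, hj⟩ := h i
  have h1 := hj u v huv
  have h2 := hj w z hwz
  have h3 := hwu i
  have h4 := hwu j
  have h5 := key duv j
  have h6 := key dwz i
  have h7 := key dwz j
  omega

theorem IsLawrenceType.eq_of_le {a : σ → ι → ℤ} (h : IsLawrenceType a) {u v w z : σ →₀ ℕ}
    (huv : IsPrimitivePair a u v) (hwz : IsPrimitivePair a w z) (hwu : w ≤ u) :
    w = u ∧ z = v :=
  huv.minimal w z hwz.ne hwz.degA_eq hwu
    (h.le_of_le huv.degA_eq hwz.degA_eq huv.disjoint hwz.disjoint hwu)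

/-- The fibre of a primitive pair `(u, v)` consists of `u` and `v` only. -/
theorem IsLawrenceType.eq_or_eq {a : σ → ι → ℤ} (h : IsLawrenceType a) {u v x : σ →₀ ℕ}
    (huv : IsPrimitivePair a u v) (hx : degA a x = degA a u) : x = u ∨ x = v := by
  by_cases hxu : x = u
  · exact Or.inl hxu
  right
  -- Divide the monomials with exponents `u` and `x` by their common factor.
  obtain ⟨u', hu'⟩ := exists_add_of_le (inf_le_left : u ⊓ x ≤ u)
  obtain ⟨x', hx'⟩ := exists_add_of_le (inf_le_right : u ⊓ x ≤ x)
  have hinf : ∀ i, (u ⊓ x) i = min (u i) (x i) := Finsupp.inf_apply u x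
  set c := u ⊓ x
  have hd : degA a u' = degA a x' := by
    rw [hu', hx', degA_add, degA_add] at hx
    exact (add_left_cancel hx).symm
  have hdis : Disjoint u'.support x'.support := by
    rw [← Finsupp.disjoint_iff, disjoint_iff]
    refine DFunLike.ext _ _ fun i => ?_
    change (u' ⊓ x') i = 0
    have h1 := DFunLike.congr_fun hu' i
    have h2 := DFunLike.congr_fun hx' i
    have h3 := hinf i
    simp only [Finsupp.add_apply, Finsupp.inf_apply] at h1 h2 ⊢
    omega
  have hle : u' ≤ u := by
    conv_rhs => rw [hu']
    exact le_add_self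
  have hne : u' ≠ x' := by
    rintro rfl
    exact hxu (hx'.trans hu'.symm)
  obtain ⟨h1, h2⟩ := huv.minimal u' x' hne hd hle
    (h.le_of_le huv.degA_eq hd huv.disjoint hdis hle)
  have hc : c = 0 := by
    rw [h1] at hu'
    exact left_eq_add.1 (hu'.trans (add_comm _ _))
  rw [hc, zero_add] at hx'
  exact hx'.trans h2

/-! ### Binomials and the toric ideal -/

variable {K : Type*} [Field K]

theorem neg_binom (u v : σ →₀ ℕ) : -binom K u v = binom K v u := by
  simp [binom]

theorem monomial_mul_binom (c u v : σ →₀ ℕ) :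
    monomial c 1 * binom K u v = binom K (c + u) (c + v) := by
  simp [binom, mul_sub, monomial_mul]

theorem coeff_binom [DecidableEq σ] (u v d : σ →₀ ℕ) :
    coeff d (binom K u v) = (if u = d then 1 else 0) - (if v = d then 1 else 0) := by
  simp [binom, coeff_monomial]

theorem mem_or_mem_of_mem_support_binom {u v d : σ →₀ ℕ} (h : d ∈ (binom K u v).support) :
    d = u ∨ d = v := by
  classical
  by_contra! hne
  rw [mem_support_iff, coeff_binom, if_neg hne.1.symm, if_neg hne.2.symm] at h
  simp at h

theorem binom_ne_zero {u v : σ →₀ ℕ} (h : u ≠ v) : binom K u v ≠ 0 := by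
  classical
  intro h0
  have := congrArg (coeff u) h0
  simp [coeff_binom, h.symm] at this

theorem binom_mem_toricIdeal {a : σ → ι → ℤ} {u v : σ →₀ ℕ} (h : degA a u = degA a v) :
    binom K u v ∈ toricIdeal K a :=
  Ideal.subset_span ⟨u, v, h, rfl⟩

/-- The coefficients of an element of the toric ideal sum to zero over each fibre, so that none of
its monomials is alone in its fibre: the toric ideal is killed by `x_i ↦ t^{a_i}`. -/
theorem exists_mem_support_degA_eq {a : σ → ι → ℤ} {f : MvPolynomial σ K}
    (hf : f ∈ toricIdeal K a) {d : σ →₀ ℕ} (hd : d ∈ f.support) :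
    ∃ d' ∈ f.support, d' ≠ d ∧ degA a d = degA a d' := by
  classical
  let φ : MvPolynomial σ K →ₐ[K] AddMonoidAlgebra K (ι → ℤ) :=
    aeval fun i => AddMonoidAlgebra.single (a i) 1
  have hφ : ∀ (u : σ →₀ ℕ) (r : K), φ (monomial u r) = AddMonoidAlgebra.single (degA a u) r := by
    intro u r
    induction u using Finsupp.induction_linear generalizing r with
    | zero => simp [φ, degA]
    | add u v hu hv =>
      rw [← mul_one r, ← monomial_mul, map_mul, hu, hv, degA_add,
        AddMonoidAlgebra.single_mul_single]
    | single i n =>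
      simp [φ, degA, aeval_monomial, AddMonoidAlgebra.single_pow,
        AddMonoidAlgebra.single_mul_single]
  have h0 : φ f = 0 := by
    have hle : toricIdeal K a ≤ RingHom.ker φ := by
      refine Ideal.span_le.2 ?_
      rintro _ ⟨u, v, h, rfl⟩
      simp [RingHom.mem_ker, binom, hφ, h]
    exact hle hf
  by_contra! hcon
  rw [f.as_sum, map_sum] at h0
  have h1 := congrArg (fun x => x.coeff (degA a d)) h0
  simp only [hφ, AddMonoidAlgebra.coeff_sum, AddMonoidAlgebra.coeff_single,
    Finsupp.finsetSum_apply, AddMonoidAlgebra.coeff_zero, Finsupp.zero_apply] at h1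
  rw [Finset.sum_eq_single d] at h1
  · simp at h1
    exact mem_support_iff.1 hd h1
  · intro b hb hbd
    exact Finsupp.single_eq_of_ne (hcon b hb hbd)
  · exact fun h => absurd hd h

theorem degA_eq_of_binom_mem {a : σ → ι → ℤ} {u v : σ →₀ ℕ}
    (h : binom K u v ∈ toricIdeal K a) : degA a u = degA a v := by
  classical
  by_cases huv : u = v
  · rw [huv]
  have hu : u ∈ (binom K u v).support := by
    simp [mem_support_iff, coeff_binom, Ne.symm huv]
  obtain ⟨d, hd, hne, hdeg⟩ := exists_mem_support_degA_eq h hu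
  rcases mem_or_mem_of_mem_support_binom hd with rfl | rfl
  · exact absurd rfl hne
  · exact hdeg

theorem mem_graverBasis_iff {a : σ → ι → ℤ} {f : MvPolynomial σ K} :
    f ∈ graverBasis (toricIdeal K a) ↔ ∃ u v, f = binom K u v ∧ IsPrimitivePair a u v := by
  constructor
  · rintro ⟨u, v, rfl, hne, hI, hdis, hmin⟩
    exact ⟨u, v, rfl, hne, degA_eq_of_binom_mem hI, hdis, fun w z hwz hd =>
      hmin w z hwz (binom_mem_toricIdeal hd)⟩
  · rintro ⟨u, v, rfl, h⟩
    exact ⟨u, v, rfl, h.ne, binom_mem_toricIdeal h.degA_eq, h.disjoint, fun w z hwz hd =>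
      h.minimal w z hwz (degA_eq_of_binom_mem hd)⟩

theorem neg_mem_graverBasis {a : σ → ι → ℤ} {f : MvPolynomial σ K}
    (hf : f ∈ graverBasis (toricIdeal K a)) : -f ∈ graverBasis (toricIdeal K a) := by
  obtain ⟨u, v, rfl, h⟩ := mem_graverBasis_iff.1 hf
  exact mem_graverBasis_iff.2 ⟨v, u, neg_binom u v, h.symm⟩

theorem span_graverBasis (a : σ → ι → ℤ) :
    Ideal.span (graverBasis (toricIdeal K a)) = toricIdeal K a := by
  apply le_antisymm
  · refine Ideal.span_le.2 ?_
    rintro f ⟨u, v, -, -, hf, -⟩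
    exact hf
  refine Ideal.span_le.2 ?_
  rintro _ ⟨u, v, huv, rfl⟩
  refine primitive_induction (a := a)
    (P := fun u v => binom K u v ∈ Ideal.span (graverBasis (toricIdeal K a)))
    (by simp [binom]) (fun u v h => Ideal.subset_span (mem_graverBasis_iff.2 ⟨u, v, rfl, h⟩))
    ?_ ?_ u v huv
  · intro u v c h
    rw [add_comm u, add_comm v, ← monomial_mul_binom]
    exact Ideal.mul_mem_left _ _ h
  · intro w z w' z' h h'
    have : binom K (w + w') (z + z') =
        monomial w' 1 * binom K w z + monomial z 1 * binom K w' z' := by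
      rw [monomial_mul_binom, monomial_mul_binom, binom, binom, binom, add_comm w' w,
        add_comm w' z]
      abel
    rw [this]
    exact add_mem (Ideal.mul_mem_left _ _ h) (Ideal.mul_mem_left _ _ h')

/-! ### Indispensability and Markov bases -/

/-- For Lawrence type, every primitive binomial is indispensable: it lies, up to sign, in every
set of binomials that generates the toric ideal. -/
theorem IsLawrenceType.mem_signClosure {a : σ → ι → ℤ} (h : IsLawrenceType a)
    {M : Set (MvPolynomial σ K)} (hM : ∀ f ∈ M, ∃ u v : σ →₀ ℕ, u ≠ v ∧ f = binom K u v)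
    (hspan : Ideal.span M = toricIdeal K a) {f : MvPolynomial σ K}
    (hf : f ∈ graverBasis (toricIdeal K a)) : f ∈ signClosure M := by
  classical
  obtain ⟨u, v, rfl, huv⟩ := mem_graverBasis_iff.1 hf
  by_contra hcon
  have hcon1 : binom K u v ∉ M := fun h => hcon (Or.inl h)
  have hcon2 : binom K v u ∉ M := fun h => hcon (Or.inr (by rwa [neg_binom]))
  have hinf : u ⊓ v = 0 := disjoint_iff.1 (Finsupp.disjoint_iff.2 huv.disjoint)
  -- A monomial multiple of an element of `M` could involve `x^u` only by being `± (x^u - x^v)`.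
  have hshift : ∀ c x y : σ →₀ ℕ, c + x = u → degA a x = degA a y → x ≠ y → x = u ∧ y = v := by
    intro c x y hcx hxy hne
    have hdeg : degA a (c + y) = degA a u := by
      rw [← hcx, degA_add, degA_add, hxy]
    rcases h.eq_or_eq huv hdeg with h1 | h1
    · exact absurd (add_left_cancel (hcx.trans h1.symm)) hne
    · have hc : c = 0 := by
        rw [← nonpos_iff_eq_zero, ← hinf]
        refine le_inf ?_ ?_
        · rw [← hcx]; exact le_self_add
        · rw [← h1]; exact le_self_add
      subst hc
      exact ⟨by simpa using hcx, by simpa using h1⟩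
  have hzero : ∀ g ∈ Ideal.span M, coeff u g = 0 := by
    intro g hg
    refine Submodule.span_induction (p := fun g _ => ∀ c, coeff u (monomial c (1 : K) * g) = 0)
      ?_ ?_ ?_ ?_ hg |> fun H => by simpa using H 0
    · intro g hg c
      obtain ⟨x, y, hne, rfl⟩ := hM g hg
      have hxy : degA a x = degA a y :=
        degA_eq_of_binom_mem (K := K) (hspan ▸ Ideal.subset_span hg)
      rw [monomial_mul_binom, coeff_binom, if_neg, if_neg, sub_zero]
      · intro hc
        obtain ⟨rfl, rfl⟩ := hshift c y x hc hxy.symm hne.symm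
        exact hcon2 hg
      · intro hc
        obtain ⟨rfl, rfl⟩ := hshift c x y hc hxy hne
        exact hcon1 hg
    · simp
    · intro x y _ _ hx hy c
      rw [mul_add, coeff_add, hx, hy, add_zero]
    · intro r x _ hx c
      rw [smul_eq_mul]
      induction r using MvPolynomial.induction_on' with
      | monomial d s =>
        have : monomial c (1 : K) * (monomial d s * x) = C s * (monomial (c + d) 1 * x) := by
          rw [← mul_assoc, monomial_mul, ← mul_assoc, C_mul_monomial, one_mul, mul_one]
        rw [this, coeff_C_mul, hx, mul_zero]
      | add p q hp hq => rw [add_mul, mul_add, coeff_add, hp, hq, add_zero]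
  have h1 := hzero (binom K u v) (hspan ▸ binom_mem_toricIdeal huv.degA_eq)
  rw [coeff_binom, if_pos rfl, if_neg huv.ne.symm, sub_zero] at h1
  exact one_ne_zero h1

theorem IsLawrenceType.signClosure_markovBasis {a : σ → ι → ℤ} (h : IsLawrenceType a)
    {M : Set (MvPolynomial σ K)} (hM : IsMarkovBasis (toricIdeal K a) M) :
    signClosure M = signClosure (graverBasis (toricIdeal K a)) := by
  obtain ⟨hbin, hspan, hmin⟩ := hM
  have hG : ∀ f ∈ graverBasis (toricIdeal K a), f ∈ signClosure M :=
    fun f hf => h.mem_signClosure hbin hspan hf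
  have hN : M ∩ graverBasis (toricIdeal K a) = M := by
    by_contra hne
    refine hmin _ (Set.inter_subset_left.ssubset_of_ne hne) (le_antisymm ?_ ?_)
    · rw [← hspan]
      exact Ideal.span_mono Set.inter_subset_left
    · refine (span_graverBasis a).ge.trans ?_
      refine Ideal.span_le.2 fun f hf => ?_
      rcases hG f hf with h1 | h1
      · exact Ideal.subset_span ⟨h1, hf⟩
      · rw [SetLike.mem_coe, ← neg_mem_iff]
        exact Ideal.subset_span ⟨h1, neg_mem_graverBasis hf⟩
  have hsub : M ⊆ graverBasis (toricIdeal K a) := Set.inter_eq_left.1 hN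
  ext f
  constructor
  · exact Or.imp (fun h => hsub h) (fun h => hsub h)
  · rintro (h1 | h1)
    · exact hG f h1
    · have := hG _ h1
      rw [signClosure, Set.mem_ofPred_eq, neg_neg] at this
      exact this.symm

/-! ### Reduced Gröbner bases -/

/-- The elements of the Graver basis with leading coefficient `1`, which amounts to choosing one
sign for each of them. -/
def monicGraver (m : MonomialOrder σ) (I : Ideal (MvPolynomial σ K)) :
    Set (MvPolynomial σ K) :=
  {f | f ∈ graverBasis I ∧ m.leadingCoeff f = 1}

theorem degree_binom (m : MonomialOrder σ) {u v : σ →₀ ℕ} (h : m.toSyn v < m.toSyn u) :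
    m.degree (binom K u v) = u := by
  classical
  rw [binom, MonomialOrder.degree_sub_of_lt] <;> simp [MonomialOrder.degree_monomial, h]

theorem leadingCoeff_binom (m : MonomialOrder σ) {u v : σ →₀ ℕ} (h : m.toSyn v < m.toSyn u) :
    m.leadingCoeff (binom K u v) = 1 := by
  classical
  have hne : v ≠ u := by
    rintro rfl
    exact lt_irrefl _ h
  rw [MonomialOrder.leadingCoeff, degree_binom m h, coeff_binom, if_pos rfl, if_neg hne, sub_zero]

theorem mem_monicGraver_or_neg_mem (m : MonomialOrder σ) {a : σ → ι → ℤ} {f : MvPolynomial σ K}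
    (hf : f ∈ graverBasis (toricIdeal K a)) :
    f ∈ monicGraver m (toricIdeal K a) ∨ -f ∈ monicGraver m (toricIdeal K a) := by
  have hf' := neg_mem_graverBasis hf
  obtain ⟨u, v, rfl, huv⟩ := mem_graverBasis_iff.1 hf
  rcases lt_or_gt_of_ne (m.toSyn.injective.ne huv.ne) with h | h
  · refine Or.inr ⟨hf', ?_⟩
    rw [neg_binom, leadingCoeff_binom m h]
  · exact Or.inl ⟨hf, leadingCoeff_binom m h⟩

theorem signClosure_monicGraver (m : MonomialOrder σ) (a : σ → ι → ℤ) :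
    signClosure (monicGraver m (toricIdeal K a)) = signClosure (graverBasis (toricIdeal K a)) := by
  ext f
  constructor
  · exact Or.imp And.left And.left
  · rintro (h | h)
    · exact mem_monicGraver_or_neg_mem m h
    · have := mem_monicGraver_or_neg_mem m h
      rw [neg_neg] at this
      exact this.symm

theorem mem_of_mem_monicGraver {m : MonomialOrder σ} {a : σ → ι → ℤ} {f : MvPolynomial σ K}
    (hf : f ∈ monicGraver m (toricIdeal K a)) : f ∈ toricIdeal K a := by
  obtain ⟨⟨u, v, -, -, h, -⟩, -⟩ := hf
  exact h

theorem exists_monicGraver_degree_le (m : MonomialOrder σ) {a : σ → ι → ℤ} {g : MvPolynomial σ K}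
    (hg : g ∈ toricIdeal K a) (h0 : g ≠ 0) :
    ∃ f ∈ monicGraver m (toricIdeal K a), m.degree f ≤ m.degree g := by
  obtain ⟨d, hd, hne, hdeg⟩ := exists_mem_support_degA_eq hg (m.degree_mem_support h0)
  have hlt : m.toSyn d < m.toSyn (m.degree g) :=
    lt_of_le_of_ne (m.le_degree hd) (m.toSyn.injective.ne hne)
  obtain ⟨w, z, hp, hw, -, hwz⟩ := exists_isPrimitivePair_le m _ _ hdeg hlt
  exact ⟨binom K w z, ⟨mem_graverBasis_iff.2 ⟨w, z, rfl, hp⟩, leadingCoeff_binom m hwz⟩,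
    by rwa [degree_binom m hwz]⟩

/-- For Lawrence type, no monomial of a primitive binomial divides a monomial of another one. -/
theorem IsLawrenceType.eq_of_degree_le {a : σ → ι → ℤ} (h : IsLawrenceType a)
    {m : MonomialOrder σ} {f g : MvPolynomial σ K} (hf : f ∈ monicGraver m (toricIdeal K a))
    (hg : g ∈ monicGraver m (toricIdeal K a)) {d : σ →₀ ℕ} (hd : d ∈ g.support)
    (hle : m.degree f ≤ d) : f = g := by
  obtain ⟨u, v, rfl, huv⟩ := mem_graverBasis_iff.1 hg.1
  obtain ⟨w, z, rfl, hwz⟩ := mem_graverBasis_iff.1 hf.1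
  have hfin : binom K w z = binom K u v ∨ binom K w z = -binom K u v := by
    rw [neg_binom]
    rcases mem_or_mem_of_mem_support_binom hd with rfl | rfl <;>
    rcases mem_or_mem_of_mem_support_binom
      (m.degree_mem_support (binom_ne_zero (K := K) hwz.ne)) with hw | hw <;> rw [hw] at hle
    · obtain ⟨rfl, rfl⟩ := h.eq_of_le huv hwz hle
      exact Or.inl rfl
    · obtain ⟨rfl, rfl⟩ := h.eq_of_le huv hwz.symm hle
      exact Or.inr rfl
    · obtain ⟨rfl, rfl⟩ := h.eq_of_le huv.symm hwz hle
      exact Or.inr rfl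
    · obtain ⟨rfl, rfl⟩ := h.eq_of_le huv.symm hwz.symm hle
      exact Or.inl rfl
  rcases hfin with h1 | h1
  · exact h1
  · have h2 := hf.2
    -- Both `g` and `-g` are monic only in characteristic two, where they agree.
    rw [h1, MonomialOrder.leadingCoeff_neg, hg.2] at h2
    have h3 : -binom K u v = C (-1) * binom K u v := by simp
    rw [h1, h3, h2, C_1, one_mul]

theorem IsLawrenceType.isReducedGroebnerBasis {a : σ → ι → ℤ} (h : IsLawrenceType a)
    (m : MonomialOrder σ) :
    IsReducedGroebnerBasis m (toricIdeal K a) (monicGraver m (toricIdeal K a)) := by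
  refine ⟨fun g hg => ⟨mem_of_mem_monicGraver hg, hg.2⟩, le_antisymm ?_ ?_,
    fun g hg f hf hne d hd hle => hne (h.eq_of_degree_le hf hg hd hle)⟩
  · exact Ideal.span_mono (Set.image_mono fun g hg => mem_of_mem_monicGraver hg)
  · refine Ideal.span_le.2 ?_
    rintro _ ⟨g, hg, rfl⟩
    by_cases h0 : g = 0
    · simp [h0]
    obtain ⟨f, hf, hle⟩ := exists_monicGraver_degree_le m hg h0
    obtain ⟨c, hc⟩ := exists_add_of_le hle
    have : m.leadingTerm g = monomial c (m.leadingCoeff g) * m.leadingTerm f := by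
      rw [MonomialOrder.leadingTerm, MonomialOrder.leadingTerm, hf.2, monomial_mul, mul_one,
        add_comm c, ← hc]
    rw [this]
    exact Ideal.mul_mem_left _ _ (Ideal.subset_span ⟨f, hf, rfl⟩)

theorem IsReducedGroebnerBasis.exists_degree_le {m : MonomialOrder σ}
    {I : Ideal (MvPolynomial σ K)} {S : Set (MvPolynomial σ K)}
    (hS : IsReducedGroebnerBasis m I S) {f : MvPolynomial σ K} (hf : f ∈ I) (h0 : f ≠ 0) :
    ∃ g ∈ S, m.degree g ≤ m.degree f := by
  classical
  have hlt : m.leadingTerm f ∈ Ideal.span (m.leadingTerm '' S) := by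
    rw [hS.2.1]
    exact Ideal.subset_span ⟨f, hf, rfl⟩
  have himg : m.leadingTerm '' S = (fun s => monomial s (1 : K)) '' (m.degree '' S) := by
    rw [Set.image_image]
    refine Set.image_congr fun g hg => ?_
    rw [MonomialOrder.leadingTerm, (hS.1 g hg).2]
  rw [himg, mem_ideal_span_monomial_image] at hlt
  obtain ⟨_, ⟨g, hg, rfl⟩, hle⟩ := hlt (m.degree f) (by
    rw [m.support_leadingTerm' h0]
    exact Finset.mem_singleton_self _)
  exact ⟨g, hg, hle⟩

/-- A reduced Gröbner basis is contained in every other one for the same term order. -/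
theorem IsReducedGroebnerBasis.subset {m : MonomialOrder σ}
    {I : Ideal (MvPolynomial σ K)} {S T : Set (MvPolynomial σ K)}
    (hS : IsReducedGroebnerBasis m I S) (hT : IsReducedGroebnerBasis m I T) : S ⊆ T := by
  classical
  intro g hg
  have hne : ∀ {U : Set (MvPolynomial σ K)}, IsReducedGroebnerBasis m I U → ∀ f ∈ U, f ≠ 0 := by
    rintro U hU f hf rfl
    simpa using (hU.1 0 hf).2
  obtain ⟨f, hf, hfg⟩ := hT.exists_degree_le (hS.1 g hg).1 (hne hS g hg)
  obtain ⟨g', hg', hgf⟩ := hS.exists_degree_le (hT.1 f hf).1 (hne hT f hf)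
  have hgg : g' = g := by
    by_contra hcon
    exact hS.2.2 g hg g' hg' hcon _ (m.degree_mem_support (hne hS g hg)) (hgf.trans hfg)
  subst hgg
  have hdeg : m.degree f = m.degree g' := le_antisymm hfg hgf
  -- A leading monomial of `g' - f` would be a reducible non-leading monomial of `g'` or of `f`.
  by_cases h0 : g' - f = 0
  · rwa [sub_eq_zero.1 h0]
  exfalso
  have hI : g' - f ∈ I := I.sub_mem (hS.1 _ hg).1 (hT.1 _ hf).1
  have hd := m.degree_mem_support h0
  set d := m.degree (g' - f) with hd_def
  have hdne : d ≠ m.degree g' := by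
    intro hEq
    rw [mem_support_iff, hEq, coeff_sub] at hd
    refine hd ?_
    have h1 := (hS.1 _ hg).2
    have h2 := (hT.1 _ hf).2
    rw [MonomialOrder.leadingCoeff] at h1 h2
    rw [hdeg] at h2
    rw [h1, h2, sub_self]
  have hno : ∀ {U : Set (MvPolynomial σ K)}, IsReducedGroebnerBasis m I U → ∀ p ∈ U,
      m.degree p = m.degree g' → d ∉ p.support := by
    intro U hU p hp hpd hdp
    obtain ⟨q, hq, hqd⟩ := hU.exists_degree_le hI h0
    refine hU.2.2 p hp q hq ?_ d hdp hqd
    rintro rfl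
    rw [hpd] at hqd
    have h1 := m.le_degree hdp
    rw [hpd] at h1
    exact hdne (m.toSyn.injective (le_antisymm h1 (m.toSyn_monotone hqd)))
  have h1 := hno hS g' hg rfl
  have h2 := hno hT f hf hdeg
  rw [notMem_support_iff] at h1 h2
  rw [mem_support_iff, coeff_sub, h1, h2, sub_zero] at hd
  exact hd rfl

theorem IsLawrenceType.isMarkovBasis_monicGraver {a : σ → ι → ℤ} (h : IsLawrenceType a)
    (m : MonomialOrder σ) :
    IsMarkovBasis (toricIdeal K a) (monicGraver m (toricIdeal K a)) := by
  have hbin : ∀ f ∈ monicGraver m (toricIdeal K a), ∃ u v : σ →₀ ℕ, u ≠ v ∧ f = binom K u v := by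
    rintro f ⟨⟨u, v, hf, hne, -⟩, -⟩
    exact ⟨u, v, hne, hf⟩
  refine ⟨hbin, le_antisymm (Ideal.span_le.2 fun f hf => mem_of_mem_monicGraver hf) ?_, ?_⟩
  · refine (span_graverBasis a).ge.trans ?_
    refine Ideal.span_le.2 fun f hf => ?_
    rcases mem_monicGraver_or_neg_mem m hf with h1 | h1
    · exact Ideal.subset_span h1
    · rw [SetLike.mem_coe, ← neg_mem_iff]
      exact Ideal.subset_span h1
  · intro N hN hspan
    refine hN.2 fun f hf => ?_
    rcases h.mem_signClosure (fun g hg => hbin g (hN.1 hg)) hspan hf.1 with h1 | h1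
    · exact h1
    · have hne : f ≠ 0 := by
        rintro rfl
        simpa using hf.2
      have : -f = f := h.eq_of_degree_le (hN.1 h1) hf (m.degree_mem_support hne)
        (by rw [MonomialOrder.degree_neg])
      rwa [this] at h1

end Toric

section UGB

universe u

variable {σ : Type u} {ι : Type*} {K : Type*} [Field K]

theorem exists_monomialOrder (σ : Type u) [Finite σ] :
    Nonempty (MonomialOrder.{u, u} σ) := by
  classical
  let _ : LinearOrder σ := IsWellOrder.linearOrder WellOrderingRel
  exact ⟨MonomialOrder.lex⟩

theorem IsLawrenceType.universalGroebnerBasis_signClosure [Finite σ] {a : σ → ι → ℤ}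
    (h : IsLawrenceType a) :
    signClosure (universalGroebnerBasis (toricIdeal K a)) =
      signClosure (graverBasis (toricIdeal K a)) := by
  obtain ⟨m₀⟩ := exists_monomialOrder σ
  have hsub : universalGroebnerBasis (toricIdeal K a) ⊆ graverBasis (toricIdeal K a) := by
    rintro f ⟨m, S, hS, hf⟩
    exact (hS.subset (h.isReducedGroebnerBasis m) hf).1
  have hsup : monicGraver m₀ (toricIdeal K a) ⊆ universalGroebnerBasis (toricIdeal K a) :=
    fun f hf => ⟨m₀, _, h.isReducedGroebnerBasis m₀, hf⟩
  apply Set.Subset.antisymm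
  · exact fun f => Or.imp (fun h => hsub h) (fun h => hsub h)
  · rw [← signClosure_monicGraver m₀]
    exact fun f => Or.imp (fun h => hsup h) (fun h => hsup h)

end UGB

/-! ### Subdivisions of graphs -/

section Graph

variable {V : Type*}

open Classical in
/-- If exactly two edges `e`, `f` contain the vertex `x`, then the `x`-coordinate of the degree is
the sum of the exponents of `e` and `f`. -/
theorem degA_edgeVector_apply {W : Type*} (H : SimpleGraph W) (u : H.edgeSet →₀ ℕ) {x : W}
    {e f : H.edgeSet} (hef : e ≠ f) (hx : ∀ g : H.edgeSet, x ∈ (g : Sym2 W) ↔ g = e ∨ g = f) :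
    degA (edgeVector H) u x = u e + u f := by
  have h : degA (edgeVector H) u x =
      u.sum fun g n => if g = e ∨ g = f then (n : ℤ) else 0 := by
    simp [degA, Finsupp.sum, edgeVector, hx]
  rw [h]
  clear h
  induction u using Finsupp.induction_linear with
  | zero => simp
  | add u v hu hv =>
    rw [Finsupp.sum_add_index', hu, hv]
    · simp only [Finsupp.add_apply]
      push_cast
      ring
    · intro g
      simp
    · intro g m n
      split_ifs <;> simp
  | single g n =>
    rw [Finsupp.sum_single_index (by simp)]
    by_cases h1 : g = e
    · subst h1
      simp [hef]
    · by_cases h2 : g = f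
      · subst h2
        simp [h1]
      · simp [h1, h2]

theorem subdivisionPoint_of_pos_of_lt (G : SimpleGraph V) {k : ℕ} (o : G.edgeSet → V × V)
    (e : G.edgeSet) {i : ℕ} (h0 : i ≠ 0) (h1 : i - 1 < k - 1) :
    subdivisionPoint G k o e i = Sum.inr (e, ⟨i - 1, h1⟩) := by
  rw [subdivisionPoint, if_neg h0, dif_pos h1]

theorem subdivisionPoint_eq_inr_iff (G : SimpleGraph V) {k : ℕ} (o : G.edgeSet → V × V)
    (e e' : G.edgeSet) (i : ℕ) (j : Fin (k - 1)) :
    subdivisionPoint G k o e' i = Sum.inr (e, j) ↔ e' = e ∧ i = j + 1 := by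
  have hj := j.2
  rw [subdivisionPoint]
  split_ifs with h0 h1
  · simp [h0]
  · simp only [Sum.inr.injEq, Prod.mk.injEq, Fin.ext_iff]
    constructor <;> rintro ⟨rfl, h⟩ <;> exact ⟨rfl, by omega⟩
  · simp only [false_iff]
    rintro ⟨-, h⟩
    omega

/-- Consecutive points of a subdivided edge are distinct: as `2 ≤ k`, one of them is new, and it
occurs only once. -/
theorem subdivisionPoint_ne_succ (G : SimpleGraph V) {k : ℕ} (hk : 2 ≤ k) (o : G.edgeSet → V × V)
    (e : G.edgeSet) {i : ℕ} (hi : i < k) :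
    subdivisionPoint G k o e i ≠ subdivisionPoint G k o e (i + 1) := by
  intro h
  by_cases h0 : i = 0
  · have h1 : i + 1 - 1 < k - 1 := by omega
    rw [subdivisionPoint_of_pos_of_lt G o e (Nat.succ_ne_zero i) h1,
      subdivisionPoint_eq_inr_iff] at h
    simp at h
  · have h1 : i - 1 < k - 1 := by omega
    rw [subdivisionPoint_of_pos_of_lt G o e h0 h1, eq_comm, subdivisionPoint_eq_inr_iff] at h
    have := h.2
    simp at this
    omega

/-- In the case `k = 2` this is where the end points of `e` have to be distinct. -/
theorem subdivisionPoint_ne_succ_succ (G : SimpleGraph V) {k : ℕ} (o : G.edgeSet → V × V)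
    (e : G.edgeSet) (he : (o e).1 ≠ (o e).2) {i : ℕ} (hi : i + 1 < k) :
    subdivisionPoint G k o e i ≠ subdivisionPoint G k o e (i + 1 + 1) := by
  intro h
  by_cases h0 : i = 0
  · subst h0
    by_cases h2 : 2 < k
    · have h1 : 0 + 1 + 1 - 1 < k - 1 := by omega
      rw [subdivisionPoint_of_pos_of_lt G o e (Nat.succ_ne_zero _) h1,
        subdivisionPoint_eq_inr_iff] at h
      simp at h
    · have h1 : ¬ 0 + 1 + 1 - 1 < k - 1 := by omega
      rw [subdivisionPoint, subdivisionPoint, if_pos rfl, if_neg (Nat.succ_ne_zero _),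
        dif_neg h1] at h
      exact he (Sum.inl_injective h)
  · have h1 : i - 1 < k - 1 := by omega
    rw [subdivisionPoint_of_pos_of_lt G o e h0 h1, eq_comm, subdivisionPoint_eq_inr_iff] at h
    have := h.2
    simp at this
    omega

theorem mem_edgeSet_subdivision (G : SimpleGraph V) {k : ℕ} (hk : 2 ≤ k) (o : G.edgeSet → V × V)
    {s : Sym2 (V ⊕ (G.edgeSet × Fin (k - 1)))} :
    s ∈ (subdivision G k o).edgeSet ↔ ∃ e : G.edgeSet, ∃ i < k,
      s = s(subdivisionPoint G k o e i, subdivisionPoint G k o e (i + 1)) := by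
  rw [subdivision, SimpleGraph.edgeSet_fromEdgeSet, Set.mem_sdiff, Set.mem_ofPred_eq,
    and_iff_left_iff_imp]
  rintro ⟨e, i, hi, rfl⟩ h
  exact subdivisionPoint_ne_succ G hk o e hi (by simpa using h)

/-- The two edges at a new vertex of the subdivision are the partners of one another, and every
edge of the subdivision has a new vertex as `2 ≤ k`. -/
theorem isLawrenceType_subdivision (G : SimpleGraph V) {k : ℕ} (hk : 2 ≤ k)
    (o : G.edgeSet → V × V) (ho : ∀ e : G.edgeSet, s((o e).1, (o e).2) = (e : Sym2 V)) :
    IsLawrenceType (edgeVector (subdivision G k o)) := by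
  -- The edges at the `(j + 1)`-st point of the path are the `j`-th and the `(j + 1)`-st.
  have key : ∀ (e : G.edgeSet) (j : ℕ) (hj : j + 1 < k)
      (f g : (subdivision G k o).edgeSet),
      (f : Sym2 _) = s(subdivisionPoint G k o e j, subdivisionPoint G k o e (j + 1)) →
      (g : Sym2 _) = s(subdivisionPoint G k o e (j + 1), subdivisionPoint G k o e (j + 1 + 1)) →
      ∀ u v : (subdivision G k o).edgeSet →₀ ℕ,
        degA (edgeVector (subdivision G k o)) u = degA (edgeVector (subdivision G k o)) v →
        u f + u g = v f + v g := by
    intro e j hj f g hf hg u v huv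
    have hj' : j < k - 1 := by omega
    have hp : ∀ e' i, subdivisionPoint G k o e' i = Sum.inr (e, ⟨j, hj'⟩) ↔ e' = e ∧ i = j + 1 :=
      fun e' i => subdivisionPoint_eq_inr_iff G o e e' i ⟨j, hj'⟩
    have hx : ∀ h : (subdivision G k o).edgeSet,
        Sum.inr (e, ⟨j, hj'⟩) ∈ (h : Sym2 (V ⊕ (G.edgeSet × Fin (k - 1)))) ↔ h = f ∨ h = g := by
      intro h
      constructor
      · intro hmem
        obtain ⟨e', i, hi, hh⟩ := (mem_edgeSet_subdivision G hk o).1 h.2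
        rw [hh, Sym2.mem_iff, @eq_comm _ (Sum.inr _), hp, @eq_comm _ (Sum.inr _), hp] at hmem
        rcases hmem with ⟨rfl, rfl⟩ | ⟨rfl, hi'⟩
        · exact Or.inr (Subtype.ext (hh.trans hg.symm))
        · obtain rfl : i = j := by omega
          exact Or.inl (Subtype.ext (hh.trans hf.symm))
      · rintro (rfl | rfl)
        · rw [hf, Sym2.mem_iff]
          exact Or.inr ((hp e (j + 1)).2 ⟨rfl, rfl⟩).symm
        · rw [hg, Sym2.mem_iff]
          exact Or.inl ((hp e (j + 1)).2 ⟨rfl, rfl⟩).symm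
    have he : (o e).1 ≠ (o e).2 := by
      have hmem : s((o e).1, (o e).2) ∈ G.edgeSet := by
        rw [ho e]
        exact e.2
      exact (G.mem_edgeSet.1 hmem).ne
    have hfg : f ≠ g := by
      intro hfg
      rw [hfg, hg, Sym2.eq_swap, Sym2.congr_left] at hf
      exact subdivisionPoint_ne_succ_succ G o e he hj hf.symm
    have h1 := congrFun huv (Sum.inr (e, ⟨j, hj'⟩))
    rw [degA_edgeVector_apply _ u hfg hx, degA_edgeVector_apply _ v hfg hx] at h1
    exact_mod_cast h1
  rintro ⟨s, hs⟩
  obtain ⟨e, i, hi, rfl⟩ := (mem_edgeSet_subdivision G hk o).1 hs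
  by_cases hlast : i + 1 < k
  · exact ⟨⟨s(subdivisionPoint G k o e (i + 1), subdivisionPoint G k o e (i + 1 + 1)),
      (mem_edgeSet_subdivision G hk o).2 ⟨e, i + 1, hlast, rfl⟩⟩, key e i hlast _ _ rfl rfl⟩
  · obtain ⟨j, rfl⟩ : ∃ j, i = j + 1 := ⟨i - 1, by omega⟩
    refine ⟨⟨s(subdivisionPoint G k o e j, subdivisionPoint G k o e (j + 1)),
      (mem_edgeSet_subdivision G hk o).2 ⟨e, j, by omega, rfl⟩⟩, fun u v huv => ?_⟩
    rw [add_comm, add_comm (v _)]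
    exact key e j hi _ _ rfl rfl u v huv

end Graph

end ToricBases


theorem proposition3p7 {K V : Type*} [Field K] [Finite V] (G : SimpleGraph V)
    (k : ℕ) (hk : 2 ≤ k)
    (o : G.edgeSet → V × V) (ho : ∀ e : G.edgeSet, s((o e).1, (o e).2) = (e : Sym2 V)) :
    (∃ M, ToricBases.IsMarkovBasis
      (ToricBases.graphIdeal K (ToricBases.subdivision G k o)) M) ∧
    ∀ M, ToricBases.IsMarkovBasis
        (ToricBases.graphIdeal K (ToricBases.subdivision G k o)) M →
      ToricBases.signClosure M =
        ToricBases.signClosure (ToricBases.universalGroebnerBasis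
          (ToricBases.graphIdeal K (ToricBases.subdivision G k o))) ∧
      ToricBases.signClosure (ToricBases.universalGroebnerBasis
          (ToricBases.graphIdeal K (ToricBases.subdivision G k o))) =
        ToricBases.signClosure (ToricBases.graverBasis
          (ToricBases.graphIdeal K (ToricBases.subdivision G k o))) := by
  have h := ToricBases.isLawrenceType_subdivision G hk o ho
  obtain ⟨m⟩ := ToricBases.exists_monomialOrder (ToricBases.subdivision G k o).edgeSet
  refine ⟨⟨_, h.isMarkovBasis_monicGraver m⟩, fun M hM => ?_⟩
  have hU := h.universalGroebnerBasis_signClosure (K := K)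
  exact ⟨(h.signClosure_markovBasis hM).trans hU.symm, hU⟩
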